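/- Let $n>2$ be an integer, let $I=(t_*,+\infty)\subset\mathbb{R}$ be an open interval and let $t_0\in I$. Consider the expanding de Sitter universe in flat FLRW form, that is, $M=I\times\mathbb{R}^n$ with the metric $$g=-dt^2+a(t)^2\left((dx^1)^2+\cdots+(dx^n)^2\right),\qquad a(t)=e^{t},$$ and let $\square_g\phi=\frac{1}{\sqrt{-\det g}}\,\partial_\mu\!\left(\sqrt{-\det g}\;g^{\mu\nu}\partial_\nu\phi\right)$ be its wave operator. Let $k$ be an integer with $k>\frac n2+2$, and let $\phi_0\in H^k(\mathbb{R}^n)$ and $\phi_1\in H^{k-1}(\mathbb{R}^n)$ be real-valued, where $H^k(\mathbb{R}^n)$ is the Sobolev space of the functions whose weak partial derivatives of all orders $\le k$ (the function itself included) are in $L^2(\mathbb{R}^n)$. Let $\phi:I\times\mathbb{R}^n\to\mathbb{R}$ be a smooth solution of the Cauchy problem $$\begin{cases}\square_g\phi=0 & (t\ge t_0,\ \mathbf{x}\in\mathbb{R}^n),\\ \phi(t_0,\mathbf{x})=\phi_0(\mathbf{x}) & (\mathbf{x}\in\mathbb{R}^n),\\ \partial_t\phi(t_0,\mathbf{x})=\phi_1(\mathbf{x})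 & (\mathbf{x}\in\mathbb{R}^n).\end{cases}$$ Then there is a constant $C$, independent of $t$, such that $$\|\partial_t\phi(t,\cdot)\|_{L^\infty(\mathbb{R}^n)}\le C\,a(t)^{-2}=C\,e^{-2t}\qquad\text{for all } t\ge t_0 .$$ -/

import Mathlib

open MeasureTheory Set
open scoped ContDiff ENNReal

noncomputable section

namespace DeSitter

/-- Flat space `ℝⁿ` with its Euclidean structure and Lebesgue measure. -/
abbrev Space (n : ℕ) : Type := EuclideanSpace ℝ (Fin n)

/-- The coordinates `(t, x)` on `ℝ × ℝⁿ`. -/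
abbrev Spacetime (n : ℕ) : Type := ℝ × Space n

/-! ### Sobolev spaces on `ℝⁿ` -/

/-- The partial derivative `∂ᵢ f` of a function on `ℝⁿ`. -/
def partialDeriv {n : ℕ} (i : Fin n) (f : Space n → ℝ) : Space n → ℝ :=
  fun x => fderiv ℝ f x (EuclideanSpace.single i 1)

/-- The iterated partial derivative `∂_{i₁} ∂_{i₂} ⋯ ∂_{iₘ} f` for `l = [i₁, …, iₘ]`. -/
def iterPartialDeriv {n : ℕ} (l : List (Fin n)) (f : Space n → ℝ) : Space n → ℝ :=
  l.foldr partialDeriv f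

/-- `g` is the weak derivative `∂_{i₁} ⋯ ∂_{iₘ} f` on `ℝⁿ`, for `l = [i₁, …, iₘ]`:
`∫ f ∂_l ψ = (-1)ᵐ ∫ g ψ` for every test function `ψ ∈ C_c^∞(ℝⁿ)`.
It is used for square-integrable `f` and `g` only. -/
def IsWeakDeriv {n : ℕ} (l : List (Fin n)) (f g : Space n → ℝ) : Prop :=
  ∀ ψ : Space n → ℝ, ContDiff ℝ ∞ ψ → HasCompactSupport ψ →
    ∫ x, f x * iterPartialDeriv l ψ x = (-1) ^ l.length * ∫ x, g x * ψ x

/-- `f ∈ H^k(ℝⁿ)`: `f` is square-integrable and has square-integrable weak partial derivatives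
of all orders up to `k`. (Lists of at most `k` indices enumerate the partial derivatives `∂^α`,
`|α| ≤ k`, as partial derivatives of a test function commute.) -/
def MemH {n : ℕ} (k : ℕ) (f : Space n → ℝ) : Prop :=
  MemLp f 2 volume ∧
    ∀ l : List (Fin n), l.length ≤ k →
      ∃ g : Space n → ℝ, MemLp g 2 volume ∧ IsWeakDeriv l f g

/-! ### The wave operator of a Lorentzian metric in the coordinates `(t, x)` -/

/-- The coordinate vectors: `∂₀ = ∂ₜ` and `∂_{i+1} = ∂/∂xⁱ` for `i : Fin n`. -/
def coordVec {n : ℕ} : Fin (n + 1) → Spacetime n :=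
  Fin.cons (1, 0) (fun i => (0, EuclideanSpace.single i 1))

/-- The coordinate derivative `∂_μ φ` of a function of `(t, x)`. -/
def coordDeriv {n : ℕ} (μ : Fin (n + 1)) (φ : Spacetime n → ℝ) : Spacetime n → ℝ :=
  fun p => fderiv ℝ φ p (coordVec μ)

/-- The d'Alembertian of a metric with components `g_{μν}`:
`□_g φ = (1 / √(-det g)) ∂_μ (√(-det g) g^{μν} ∂_ν φ)`. -/
def dAlembertian {n : ℕ} (g : Spacetime n → Matrix (Fin (n + 1)) (Fin (n + 1)) ℝ)
    (φ : Spacetime n → ℝ) : Spacetime n → ℝ :=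
  fun p => (√(-(g p).det))⁻¹ *
    ∑ μ, coordDeriv μ (fun q => √(-(g q).det) * ∑ ν, (g q)⁻¹ μ ν * coordDeriv ν φ q) p

/-- The scale factor `a(t) = e^t`. -/
def scaleFactor (t : ℝ) : ℝ := Real.exp t

/-- The de Sitter metric in flat FLRW form, `g = -dt² + a(t)² ((dx¹)² + ⋯ + (dxⁿ)²)`. -/
def metric (n : ℕ) : Spacetime n → Matrix (Fin (n + 1)) (Fin (n + 1)) ℝ :=
  fun p => Matrix.diagonal (Fin.cons (-1) (fun _ => scaleFactor p.1 ^ 2))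

end DeSitter

end

/-! For this metric the equation reads `φ_tt + n φ_t = e^{-2t} Δφ`. At a fixed point `x` this is a
linear ODE for `φ_t` with source `e^{-2t} Δφ`, that is `(e^{nt} φ_t)' = e^{(n-2)t} Δφ`. If `Δφ` is
bounded uniformly in `t ≥ t₀` and `x`, integration gives `φ_t = O(e^{-2t})`: for `n > 2` the
homogeneous part `e^{-nt}` decays faster than the forced part (`le_mul_exp_of_hasDerivAt`).

The bound on `Δφ` comes from energy and Sobolev estimates. The energy `∫ e^{2t} ψ_t² + |∇ψ|²` of a
solution does not increase, since its density has time derivative `(2 - 2n) e^{2t} ψ_t²` plus a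
spatial divergence. Spatial derivatives of solutions are solutions, so this applies to `ψ = ∂ᵢ^m ∂ⱼ
φ` with `m ≤ s`, where `k = s + 2` and `s > n/2`; the data have exactly enough derivatives for the
initial energies to be finite. Hence `∂ᵢ^m (∂ⱼ² φ)` is bounded in `L²` uniformly in time, and a
Sobolev inequality bounds `∂ⱼ² φ` pointwise.

Only the initial data are assumed square-integrable, so nothing is known about decay in `x` at later
times. The energy is therefore multiplied by a cutoff with spacelike level sets
(`coneCutoff_flux_nonpos`, `antitoneOn_integral_energyDensity`). This yields `L²` bounds on unit
balls, uniform in the centre, and the Sobolev inequality is used in the matching local form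
(`exists_abs_le_of_forall_setIntegral_le`). -/

namespace DeSitter

/-! ### Directional derivatives -/

section DirDeriv

variable {E : Type*} [NormedAddCommGroup E] [NormedSpace ℝ E]

/-- The derivative of `f` in the direction `v`. -/
noncomputable def dirDeriv (v : E) (f : E → ℝ) : E → ℝ := fun x => fderiv ℝ f x v

theorem contDiff_dirDeriv {f : E → ℝ} (hf : ContDiff ℝ ∞ f) (v : E) :
    ContDiff ℝ ∞ (dirDeriv v f) :=
  (hf.fderiv_right (m := ∞) (by simp)).clm_apply contDiff_const

theorem contDiff_iterate_dirDeriv {f : E → ℝ} (hf : ContDiff ℝ ∞ f) (v : E) (m : ℕ) :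
    ContDiff ℝ ∞ ((dirDeriv v)^[m] f) := by
  induction m generalizing f with
  | zero => exact hf
  | succ m ih => exact ih (contDiff_dirDeriv hf v)

theorem dirDeriv_add {f g : E → ℝ} (hf : ContDiff ℝ ∞ f) (hg : ContDiff ℝ ∞ g) (v : E) :
    dirDeriv v (fun x => f x + g x) = fun x => dirDeriv v f x + dirDeriv v g x := by
  ext x
  have hf' := (hf.differentiable (by simp)) x
  have hg' := (hg.differentiable (by simp)) x
  simp [dirDeriv, fderiv_fun_add hf' hg']

theorem dirDeriv_mul {f g : E → ℝ} (hf : ContDiff ℝ ∞ f) (hg : ContDiff ℝ ∞ g) (v : E) :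
    dirDeriv v (fun x => f x * g x)
      = fun x => dirDeriv v f x * g x + f x * dirDeriv v g x := by
  ext x
  have hf' := (hf.differentiable (by simp)) x
  have hg' := (hg.differentiable (by simp)) x
  simp [dirDeriv, fderiv_fun_mul hf' hg']
  ring

theorem dirDeriv_sum {ι : Type*} (s : Finset ι) {f : ι → E → ℝ}
    (hf : ∀ i ∈ s, ContDiff ℝ ∞ (f i)) (v : E) :
    dirDeriv v (fun x => ∑ i ∈ s, f i x) = fun x => ∑ i ∈ s, dirDeriv v (f i) x := by
  ext x
  have hf' : ∀ i ∈ s, DifferentiableAt ℝ (f i) x :=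
    fun i hi => ((hf i hi).differentiable (by simp)) x
  simp [dirDeriv, fderiv_fun_sum hf']

theorem dirDeriv_comm {f : E → ℝ} (hf : ContDiff ℝ ∞ f) (v w : E) :
    dirDeriv v (dirDeriv w f) = dirDeriv w (dirDeriv v f) := by
  ext x
  have hd : DifferentiableAt ℝ (fderiv ℝ f) x :=
    ((hf.fderiv_right (m := ∞) (by simp)).differentiable (by simp)) x
  have key : ∀ a b : E, dirDeriv a (dirDeriv b f) x = fderiv ℝ (fderiv ℝ f) x a b := by
    intro a b
    change fderiv ℝ (fun y => fderiv ℝ f y b) x a = _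
    rw [fderiv_clm_apply hd (by fun_prop)]
    simp
  rw [key, key]
  exact ((contDiff_infty.1 hf 2).contDiffAt.isSymmSndFDerivAt (by simp)).eq v w

theorem dirDeriv_iterate_comm {f : E → ℝ} (hf : ContDiff ℝ ∞ f) (v w : E) (m : ℕ) :
    dirDeriv v ((dirDeriv w)^[m] f) = (dirDeriv w)^[m] (dirDeriv v f) := by
  induction m generalizing f with
  | zero => rfl
  | succ m ih =>
    rw [Function.iterate_succ_apply, Function.iterate_succ_apply,
      ih (contDiff_dirDeriv hf w), dirDeriv_comm hf]

theorem iterate_dirDeriv_add {f g : E → ℝ} (hf : ContDiff ℝ ∞ f) (hg : ContDiff ℝ ∞ g) (v : E)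
    (m : ℕ) : (dirDeriv v)^[m] (fun x => f x + g x)
      = fun x => (dirDeriv v)^[m] f x + (dirDeriv v)^[m] g x := by
  induction m generalizing f g with
  | zero => rfl
  | succ m ih =>
    simp only [Function.iterate_succ_apply]
    rw [dirDeriv_add hf hg, ih (contDiff_dirDeriv hf v) (contDiff_dirDeriv hg v)]

theorem tsupport_dirDeriv_subset (f : E → ℝ) (v : E) : tsupport (dirDeriv v f) ⊆ tsupport f :=
  tsupport_fderiv_apply_subset ℝ v

theorem tsupport_iterate_dirDeriv_subset (f : E → ℝ) (v : E) (m : ℕ) :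
    tsupport ((dirDeriv v)^[m] f) ⊆ tsupport f := by
  induction m generalizing f with
  | zero => exact subset_rfl
  | succ m ih => exact (ih _).trans (tsupport_dirDeriv_subset f v)

theorem hasCompactSupport_dirDeriv {f : E → ℝ} (hf : HasCompactSupport f) (v : E) :
    HasCompactSupport (dirDeriv v f) :=
  hf.of_isClosed_subset (isClosed_tsupport _) (tsupport_dirDeriv_subset f v)

theorem dirDeriv_comp_add (f : E → ℝ) (v a : E) :
    dirDeriv v (fun x => f (x + a)) = fun x => dirDeriv v f (x + a) := by
  ext x
  simp [dirDeriv, fderiv_comp_add_right]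

theorem iterate_dirDeriv_comp_add (f : E → ℝ) (v a : E) (m : ℕ) :
    (dirDeriv v)^[m] (fun x => f (x + a)) = fun x => (dirDeriv v)^[m] f (x + a) := by
  induction m generalizing f with
  | zero => rfl
  | succ m ih => rw [Function.iterate_succ_apply, dirDeriv_comp_add, ih]; rfl

variable [FiniteDimensional ℝ E] [MeasurableSpace E] [BorelSpace E]
  {μ : Measure E} [μ.IsAddHaarMeasure]

theorem integral_mul_dirDeriv {f g : E → ℝ} (hf : ContDiff ℝ ∞ f) (hg : ContDiff ℝ ∞ g)
    (hc : HasCompactSupport g) (v : E) :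
    ∫ x, f x * dirDeriv v g x ∂μ = -∫ x, dirDeriv v f x * g x ∂μ := by
  have hf' := (contDiff_dirDeriv hf v).continuous
  have hg' := (contDiff_dirDeriv hg v).continuous
  have hc' := hasCompactSupport_dirDeriv hc v
  exact integral_mul_fderiv_eq_neg_fderiv_mul_of_integrable
    ((hf'.mul hg.continuous).integrable_of_hasCompactSupport hc.mul_left)
    ((hf.continuous.mul hg').integrable_of_hasCompactSupport hc'.mul_left)
    ((hf.continuous.mul hg.continuous).integrable_of_hasCompactSupport hc.mul_left)
    (fun x _ => hf.differentiable (by simp) x) (fun x _ => hg.differentiable (by simp) x)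

theorem integral_dirDeriv_eq_zero {g : E → ℝ} (hg : ContDiff ℝ ∞ g)
    (hc : HasCompactSupport g) (v : E) : ∫ x, dirDeriv v g x ∂μ = 0 := by
  have h := integral_mul_dirDeriv (μ := μ) (f := fun _ => 1) contDiff_const hg hc v
  simpa [dirDeriv] using h

end DirDeriv

/-! ### A Sobolev inequality -/

section Sobolev

open scoped FourierTransform SchwartzMap LineDeriv Real

theorem norm_fourier_iterate_lineDerivOp {n : ℕ} (f : 𝓢(Space n, ℂ)) (v ξ : Space n) (m : ℕ) :
    ‖𝓕 ((fun g : 𝓢(Space n, ℂ) => ∂_{v} g)^[m] f) ξ‖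
      = (2 * π * |inner ℝ ξ v|) ^ m * ‖𝓕 f ξ‖ := by
  induction m generalizing f with
  | zero => simp
  | succ m ih =>
    rw [Function.iterate_succ_apply, ih, SchwartzMap.fourier_lineDerivOp_eq]
    have : (inner ℝ · v : Space n → ℝ).HasTemperateGrowth := by fun_prop
    simp [SchwartzMap.smulLeftCLM_apply_apply this, abs_of_pos Real.pi_pos]
    ring

theorem norm_apply_le_integral_norm_fourier {n : ℕ} (f : 𝓢(Space n, ℂ)) (x : Space n) :
    ‖f x‖ ≤ ∫ ξ, ‖𝓕 f ξ‖ := by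
  have h : f x = 𝓕⁻ (𝓕 f) x := by rw [FourierTransform.fourierInv_fourier_eq]
  rw [h, SchwartzMap.fourierInv_coe, Real.fourierInv_eq]
  refine (norm_integral_le_integral_norm _).trans_eq ?_
  simp

/-- Power mean inequality for the `n + 1` numbers `1, ξ₁², …, ξₙ²`. It lets the pure derivatives
`∂ᵢ^s` alone control the `H^s` weight, so mixed derivatives are never needed. -/
theorem one_add_norm_sq_pow_le {n : ℕ} (ξ : Space n) {s : ℕ} (hs : s ≠ 0) :
    (1 + ‖ξ‖ ^ 2) ^ s ≤ (n + 1) ^ s * (1 + ∑ i, (|ξ i| ^ s) ^ 2) := by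
  obtain ⟨r, rfl⟩ := Nat.exists_eq_succ_of_ne_zero hs
  have h := pow_sum_div_card_le_sum_pow (s := Finset.univ)
    (f := fun o : Option (Fin n) => o.elim (1 : ℝ) fun i => ξ i ^ 2)
    (by rintro (_ | i) _ <;> simp [sq_nonneg]) r
  simp only [Fintype.sum_option, Option.elim, Finset.card_univ, Fintype.card_option,
    Fintype.card_fin, one_pow, Nat.cast_add, Nat.cast_one] at h
  rw [div_le_iff₀' (by positivity)] at h
  have h2 : ∀ i, (|ξ i| ^ (r + 1)) ^ 2 = (ξ i ^ 2) ^ (r + 1) := fun i => by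
    rw [← sq_abs (ξ i), pow_right_comm]
  simp only [EuclideanSpace.norm_sq_eq, Real.norm_eq_abs, sq_abs, Nat.succ_eq_add_one, h2]
  refine h.trans ?_
  gcongr
  · simp
  · simp

/-- The inequality `‖f‖_∞ ≤ C (1 + ‖f‖²_{H^s})` for Schwartz functions, `s > n / 2`. -/
theorem exists_norm_le_of_schwartz {n s : ℕ} (hs : n < 2 * s) :
    ∃ C : ℝ, 0 ≤ C ∧ ∀ f : 𝓢(Space n, ℂ), ∀ x, ‖f x‖ ≤ C * (1 + ((∫ x, ‖f x‖ ^ 2) +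
      ∑ i : Fin n, ∫ x, ‖((fun g : 𝓢(Space n, ℂ) =>
        ∂_{(EuclideanSpace.single i (1 : ℝ) : Space n)} g)^[s] f) x‖ ^ 2)) := by
  have hint : Integrable (fun ξ : Space n => ((1 + ‖ξ‖ ^ 2) ^ s)⁻¹) := by
    have h := integrable_rpow_neg_one_add_norm_sq (E := Space n) (μ := volume) (r := 2 * s)
      (by simpa using (by exact_mod_cast hs : (n : ℝ) < 2 * s))
    refine h.congr (.of_forall fun ξ => ?_)
    have : -(2 * (s : ℝ)) / 2 = -(s : ℝ) := by ring
    simp only [this]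
    rw [Real.rpow_neg (by positivity), Real.rpow_natCast]
  have hsq : ∀ g : 𝓢(Space n, ℂ), Integrable (fun ξ => ‖g ξ‖ ^ 2) :=
    fun g => (g.memLp 2).integrable_norm_pow (by simp)
  have hA : 0 ≤ ∫ ξ : Space n, ((1 + ‖ξ‖ ^ 2) ^ s)⁻¹ := integral_nonneg fun ξ => by positivity
  refine ⟨(∫ ξ : Space n, ((1 + ‖ξ‖ ^ 2) ^ s)⁻¹) + (n + 1) ^ s, by positivity, fun f x => ?_⟩
  set D : Fin n → 𝓢(Space n, ℂ) := fun i => (fun g : 𝓢(Space n, ℂ) =>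
    ∂_{(EuclideanSpace.single i (1 : ℝ) : Space n)} g)^[s] f with hD
  have hpt : ∀ ξ : Space n, ‖𝓕 f ξ‖ ≤ ((1 + ‖ξ‖ ^ 2) ^ s)⁻¹
      + (n + 1) ^ s * (‖𝓕 f ξ‖ ^ 2 + ∑ i, ‖𝓕 (D i) ξ‖ ^ 2) := by
    intro ξ
    set p := (1 + ‖ξ‖ ^ 2) ^ s with hp
    have hp0 : 0 < p := by positivity
    set F := ‖𝓕 f ξ‖
    have hF : 0 ≤ F := norm_nonneg _
    -- A pointwise AM-GM replaces Cauchy–Schwarz in `∫ |𝓕 f|`. This is why the final bound has the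
    -- inhomogeneous form `1 + ‖f‖²`, which is enough for boundedness.
    have h1 : F ≤ p⁻¹ + p * F ^ 2 := by
      have h : 0 ≤ p⁻¹ * (1 - p * F) ^ 2 := by positivity
      have e : p⁻¹ * (1 - p * F) ^ 2 = p⁻¹ + p * F ^ 2 - 2 * F := by field_simp; ring
      linarith
    have h2 : p * F ^ 2 ≤ (n + 1) ^ s * (1 + ∑ i, (|ξ i| ^ s) ^ 2) * F ^ 2 := by
      gcongr
      exact one_add_norm_sq_pow_le ξ (by omega)
    have h3 : ∀ i, (|ξ i| ^ s) ^ 2 * F ^ 2 ≤ ‖𝓕 (D i) ξ‖ ^ 2 := by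
      intro i
      rw [hD, norm_fourier_iterate_lineDerivOp, ← mul_pow]
      have : |inner ℝ ξ (EuclideanSpace.single i (1 : ℝ))| = |ξ i| := by
        simp [EuclideanSpace.inner_single_right]
      rw [this]
      gcongr
      have := Real.pi_gt_three
      have := abs_nonneg (ξ i)
      nlinarith
    have h4 : ∑ i, (|ξ i| ^ s) ^ 2 * F ^ 2 ≤ ∑ i, ‖𝓕 (D i) ξ‖ ^ 2 :=
      Finset.sum_le_sum fun i _ => h3 i
    calc F ≤ p⁻¹ + (n + 1) ^ s * (1 + ∑ i, (|ξ i| ^ s) ^ 2) * F ^ 2 := by linarith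
      _ = p⁻¹ + (n + 1) ^ s * (F ^ 2 + ∑ i, (|ξ i| ^ s) ^ 2 * F ^ 2) := by
        rw [← Finset.sum_mul]; ring
      _ ≤ _ := by gcongr
  have hI1 : Integrable (fun ξ => ∑ i, ‖𝓕 (D i) ξ‖ ^ 2) :=
    integrable_finsetSum _ fun i _ => hsq (𝓕 (D i))
  have hI2 : Integrable (fun ξ => ‖𝓕 f ξ‖ ^ 2 + ∑ i, ‖𝓕 (D i) ξ‖ ^ 2) := (hsq (𝓕 f)).add hI1
  have hS : 0 ≤ (∫ x, ‖f x‖ ^ 2) + ∑ i, ∫ x, ‖D i x‖ ^ 2 := by positivity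
  calc ‖f x‖ ≤ ∫ ξ, ‖𝓕 f ξ‖ := norm_apply_le_integral_norm_fourier f x
    _ ≤ ∫ ξ, (((1 + ‖ξ‖ ^ 2) ^ s)⁻¹
        + (n + 1) ^ s * (‖𝓕 f ξ‖ ^ 2 + ∑ i, ‖𝓕 (D i) ξ‖ ^ 2)) :=
      integral_mono (𝓕 f).integrable.norm (hint.add (hI2.const_mul _)) hpt
    _ = (∫ ξ : Space n, ((1 + ‖ξ‖ ^ 2) ^ s)⁻¹)
        + (n + 1) ^ s * ((∫ x, ‖f x‖ ^ 2) + ∑ i, ∫ x, ‖D i x‖ ^ 2) := by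
      rw [integral_add hint (hI2.const_mul _), integral_const_mul, integral_add (hsq (𝓕 f)) hI1,
        integral_finsetSum _ fun i _ => hsq (𝓕 (D i))]
      simp only [SchwartzMap.integral_norm_sq_fourier]
    _ ≤ _ := by
      have : (0 : ℝ) ≤ (n + 1) ^ s := by positivity
      nlinarith [mul_nonneg hA hS]

/-- `L²` bounds for the derivatives of `χ f` in one direction, where `χ` is a fixed cutoff. -/
theorem exists_integral_iterate_dirDeriv_mul_sq_le {n : ℕ} (v : Space n) (m : ℕ)
    {χ : Space n → ℝ} (hχ : ContDiff ℝ ∞ χ) (hs : tsupport χ ⊆ Metric.closedBall 0 1) :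
    ∃ C : ℝ, 0 ≤ C ∧ ∀ f : Space n → ℝ, ContDiff ℝ ∞ f → ∀ M : ℝ,
      (∀ j ≤ m, ∫ x in Metric.closedBall 0 1, ((dirDeriv v)^[j] f x) ^ 2 ≤ M) →
      ∫ x, ((dirDeriv v)^[m] (fun x => χ x * f x) x) ^ 2 ≤ C * M := by
  -- By the Leibniz rule one derivative falls either on the cutoff or on `f`, so the induction
  -- hypothesis is needed both for `χ` and for `∂ᵥ χ`.
  induction m generalizing χ with
  | zero =>
    obtain ⟨c, hc⟩ := (isCompact_closedBall (0 : Space n) 1).exists_bound_of_continuousOn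
      hχ.continuous.continuousOn
    refine ⟨c ^ 2, sq_nonneg c, fun f hf M hM => ?_⟩
    have hM := hM 0 le_rfl
    simp only [Function.iterate_zero, id] at hM ⊢
    have hzero : ∀ x, x ∉ Metric.closedBall (0 : Space n) 1 → (χ x * f x) ^ 2 = 0 := by
      intro x hx
      rw [image_eq_zero_of_notMem_tsupport fun h => hx (hs h)]
      simp
    rw [← setIntegral_eq_integral_of_forall_compl_eq_zero hzero]
    have hfc := hf.continuous
    have hχc := hχ.continuous
    have hK := isCompact_closedBall (0 : Space n) 1
    calc ∫ x in Metric.closedBall 0 1, (χ x * f x) ^ 2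
        ≤ ∫ x in Metric.closedBall 0 1, c ^ 2 * f x ^ 2 := by
          refine setIntegral_mono_on
            ((by fun_prop : Continuous fun x => (χ x * f x) ^ 2).continuousOn.integrableOn_compact
              hK)
            ((by fun_prop : Continuous fun x => c ^ 2 * f x ^ 2).continuousOn.integrableOn_compact
              hK)
            measurableSet_closedBall fun x hx => ?_
          rw [mul_pow]
          have := hc x hx
          have : χ x ^ 2 ≤ c ^ 2 := by
            rw [← sq_abs]
            exact pow_le_pow_left₀ (abs_nonneg _) this 2
          gcongr
      _ = c ^ 2 * ∫ x in Metric.closedBall 0 1, f x ^ 2 := integral_const_mul _ _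
      _ ≤ c ^ 2 * M := by gcongr
  | succ m ih =>
    obtain ⟨C₁, hC₁, h₁⟩ := ih (contDiff_dirDeriv hχ v) ((tsupport_dirDeriv_subset χ v).trans hs)
    obtain ⟨C₂, hC₂, h₂⟩ := ih hχ hs
    refine ⟨2 * (C₁ + C₂), by positivity, fun f hf M hM => ?_⟩
    have hf' := contDiff_dirDeriv hf v
    have hχ' := contDiff_dirDeriv hχ v
    have hχc : HasCompactSupport χ :=
      (isCompact_closedBall (0 : Space n) 1).of_isClosed_subset (isClosed_tsupport _) hs
    have b₁ := h₁ f hf M fun j hj => hM j (by omega)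
    have b₂ := h₂ (dirDeriv v f) hf' M fun j hj => by
      simpa only [← Function.iterate_succ_apply] using hM (j + 1) (by omega)
    have hint : ∀ g h : Space n → ℝ, ContDiff ℝ ∞ g → ContDiff ℝ ∞ h → HasCompactSupport g →
        Integrable (fun x => ((dirDeriv v)^[m] (fun x => g x * h x) x) ^ 2) := by
      intro g h hg hh hgc
      have hgh : HasCompactSupport (fun x => g x * h x) := hgc.mul_right
      have hc : HasCompactSupport ((dirDeriv v)^[m] (fun x => g x * h x)) :=
        hgh.of_isClosed_subset (isClosed_tsupport _) (tsupport_iterate_dirDeriv_subset _ v m)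
      have hcont := (contDiff_iterate_dirDeriv (hg.mul hh) v m).continuous
      have hc2 : HasCompactSupport fun x => ((dirDeriv v)^[m] (fun x => g x * h x) x) ^ 2 :=
        hc.comp_left (g := fun y : ℝ => y ^ 2) (by simp)
      exact (hcont.pow 2).integrable_of_hasCompactSupport hc2
    have i₁ := hint _ f hχ' hf (hasCompactSupport_dirDeriv hχc v)
    have i₂ := hint χ _ hχ hf' hχc
    rw [Function.iterate_succ_apply, dirDeriv_mul hχ hf,
      iterate_dirDeriv_add (hχ'.mul hf) (hχ.mul hf')]
    calc ∫ x, ((dirDeriv v)^[m] (fun x => dirDeriv v χ x * f x) x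
            + (dirDeriv v)^[m] (fun x => χ x * dirDeriv v f x) x) ^ 2
        ≤ ∫ x, (2 * ((dirDeriv v)^[m] (fun x => dirDeriv v χ x * f x) x) ^ 2
            + 2 * ((dirDeriv v)^[m] (fun x => χ x * dirDeriv v f x) x) ^ 2) := by
          refine integral_mono_of_nonneg (.of_forall fun x => sq_nonneg _)
            ((i₁.const_mul 2).add (i₂.const_mul 2)) (.of_forall fun x => ?_)
          simp only
          nlinarith [sq_nonneg ((dirDeriv v)^[m] (fun x => dirDeriv v χ x * f x) x
            - (dirDeriv v)^[m] (fun x => χ x * dirDeriv v f x) x)]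
      _ ≤ 2 * (C₁ + C₂) * M := by
          rw [integral_add (i₁.const_mul 2) (i₂.const_mul 2), integral_const_mul,
            integral_const_mul]
          linarith

/-- A local Sobolev inequality, uniform with respect to translations. -/
theorem exists_abs_le_of_forall_setIntegral_le {n s : ℕ} (hs : n < 2 * s) :
    ∃ C : ℝ, ∀ f : Space n → ℝ, ContDiff ℝ ∞ f → ∀ M : ℝ, 0 ≤ M → ∀ x₀ : Space n,
      (∀ i, ∀ m ≤ s, ∫ x in Metric.closedBall x₀ 1,
        ((dirDeriv (EuclideanSpace.single i (1 : ℝ)))^[m] f x) ^ 2 ≤ M) →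
      (∫ x in Metric.closedBall x₀ 1, f x ^ 2 ≤ M) → |f x₀| ≤ C * (1 + M) := by
  obtain ⟨C, hC, hSob⟩ := exists_norm_le_of_schwartz hs
  let b : ContDiffBump (0 : Space n) := ⟨1 / 2, 1, by norm_num, by norm_num⟩
  have hb : ContDiff ℝ ∞ b := b.contDiff
  have hbs : tsupport b ⊆ Metric.closedBall 0 1 := b.tsupport_eq.subset
  choose K hK hL using fun i : Fin n =>
    exists_integral_iterate_dirDeriv_mul_sq_le (EuclideanSpace.single i (1 : ℝ)) s hb hbs
  -- Order zero: this handles the undifferentiated term of the Sobolev norm. The direction `0` plays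
  -- no role, since no derivative is taken.
  obtain ⟨K₀, hK₀, hL₀⟩ := exists_integral_iterate_dirDeriv_mul_sq_le (0 : Space n) 0 hb hbs
  refine ⟨C * (1 + (K₀ + ∑ i, K i)), fun f hf M hM x₀ hfM hf₀ => ?_⟩
  have htrans : ∀ h : Space n → ℝ, ∫ x in Metric.closedBall 0 1, h (x + x₀)
      = ∫ x in Metric.closedBall x₀ 1, h x := by
    intro h
    rw [← (measurePreserving_add_right volume x₀).setIntegral_preimage_emb
      (measurableEmbedding_addRight x₀) h]
    congr 2
    ext x
    simp [dist_eq_norm]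
  have hg : ContDiff ℝ ∞ fun x => f (x + x₀) := by fun_prop
  have hχg : ContDiff ℝ ∞ fun x => b x * f (x + x₀) := hb.mul hg
  have hsupp : HasCompactSupport fun x => b x * f (x + x₀) := b.hasCompactSupport.mul_right
  have hsuppC : HasCompactSupport fun x => ((b x * f (x + x₀) : ℝ) : ℂ) :=
    hsupp.comp_left (g := Complex.ofReal) (by simp)
  let F : 𝓢(Space n, ℂ) := hsuppC.toSchwartzMap (Complex.ofRealCLM.contDiff.comp hχg)
  have hF : ∀ x, F x = ((b x * f (x + x₀) : ℝ) : ℂ) := fun x => rfl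
  have hder : ∀ (v : Space n) (m : ℕ) (G : 𝓢(Space n, ℂ)) (g : Space n → ℝ), ContDiff ℝ ∞ g →
      (∀ x, G x = (g x : ℂ)) →
      ∀ x, ((fun g : 𝓢(Space n, ℂ) => ∂_{v} g)^[m] G) x = (((dirDeriv v)^[m] g x : ℝ) : ℂ) := by
    intro v m
    induction m with
    | zero => intro G g _ h x; exact h x
    | succ m ih =>
      intro G g hg h x
      refine ih _ _ (contDiff_dirDeriv hg v) (fun y => ?_) x
      rw [SchwartzMap.lineDerivOp_apply_eq_fderiv,
        show (G : Space n → ℂ) = Complex.ofRealCLM ∘ g from funext h,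
        fderiv_comp _ (by fun_prop) (hg.differentiable (by simp) y)]
      simp [dirDeriv]
  have h0 := hSob F 0
  have e1 : ∫ x, ‖F x‖ ^ 2 ≤ K₀ * M := by
    have := hL₀ _ hg M fun j hj => by
      obtain rfl : j = 0 := by omega
      simpa [htrans fun x => f x ^ 2] using hf₀
    simpa [hF, sq_abs, ← mul_pow, ← abs_mul] using this
  have e2 : ∀ i, ∫ x, ‖((fun g : 𝓢(Space n, ℂ) =>
        ∂_{(EuclideanSpace.single i (1 : ℝ) : Space n)} g)^[s] F) x‖ ^ 2 ≤ K i * M := by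
    intro i
    have := hL i _ hg M fun j hj => by
      rw [iterate_dirDeriv_comp_add]
      simpa only [htrans fun x => (((dirDeriv (EuclideanSpace.single i (1 : ℝ)))^[j] f) x) ^ 2]
        using hfM i j hj
    simp only [hder _ s F _ hχg hF, Complex.norm_real, Real.norm_eq_abs, sq_abs]
    exact this
  have hb0 : b 0 = 1 := b.one_of_mem_closedBall (Metric.mem_closedBall_self b.rIn_pos.le)
  have hF0 : ‖F 0‖ = |f x₀| := by simp [hF, hb0]
  rw [hF0] at h0
  have hKs : 0 ≤ ∑ i, K i := Finset.sum_nonneg fun i _ => hK i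
  refine h0.trans ?_
  rw [mul_assoc]
  gcongr
  have e3 := Finset.sum_le_sum fun i (_ : i ∈ Finset.univ) => e2 i
  rw [← Finset.sum_mul] at e3
  nlinarith

end Sobolev

/-! ### Classical derivatives of smooth functions in `H^k` -/

section Weak

variable {n : ℕ}

theorem iterPartialDeriv_cons (i : Fin n) (l : List (Fin n)) (f : Space n → ℝ) :
    iterPartialDeriv (i :: l) f
      = dirDeriv (EuclideanSpace.single i (1 : ℝ)) (iterPartialDeriv l f) := rfl

theorem contDiff_iterPartialDeriv (l : List (Fin n)) {f : Space n → ℝ} (hf : ContDiff ℝ ∞ f) :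
    ContDiff ℝ ∞ (iterPartialDeriv l f) := by
  induction l with
  | nil => exact hf
  | cons i l ih => exact contDiff_dirDeriv ih _

theorem hasCompactSupport_iterPartialDeriv (l : List (Fin n)) {f : Space n → ℝ}
    (hf : HasCompactSupport f) : HasCompactSupport (iterPartialDeriv l f) := by
  induction l with
  | nil => exact hf
  | cons i l ih => exact hasCompactSupport_dirDeriv ih _

theorem iterPartialDeriv_dirDeriv (l : List (Fin n)) {f : Space n → ℝ} (hf : ContDiff ℝ ∞ f)
    (v : Space n) : iterPartialDeriv l (dirDeriv v f) = dirDeriv v (iterPartialDeriv l f) := by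
  induction l with
  | nil => rfl
  | cons i l ih =>
    rw [iterPartialDeriv_cons, ih, iterPartialDeriv_cons,
      dirDeriv_comm (contDiff_iterPartialDeriv l hf)]

theorem isWeakDeriv_iterPartialDeriv (l : List (Fin n)) {f : Space n → ℝ}
    (hf : ContDiff ℝ ∞ f) : IsWeakDeriv l f (iterPartialDeriv l f) := by
  intro ψ hψ hc
  induction l generalizing f with
  | nil => simp [iterPartialDeriv]
  | cons i l ih =>
    rw [iterPartialDeriv_cons, integral_mul_dirDeriv hf (contDiff_iterPartialDeriv l hψ)
      (hasCompactSupport_iterPartialDeriv l hc), ih (contDiff_dirDeriv hf _),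
      iterPartialDeriv_dirDeriv l hf, iterPartialDeriv_cons, List.length_cons]
    ring

/-- A classical derivative is also a weak one, and weak derivatives are unique almost everywhere by
the fundamental lemma of the calculus of variations. -/
theorem MemH.memLp_iterPartialDeriv {k : ℕ} {f : Space n → ℝ} (h : MemH k f)
    (hf : ContDiff ℝ ∞ f) {l : List (Fin n)} (hl : l.length ≤ k) :
    MemLp (iterPartialDeriv l f) 2 volume := by
  obtain ⟨g, hg, hw⟩ := h.2 l hl
  refine hg.ae_eq ?_
  refine ae_eq_of_integral_contDiff_smul_eq (hg.locallyIntegrable (by norm_num))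
    (contDiff_iterPartialDeriv l hf).continuous.locallyIntegrable fun ψ hψ hc => ?_
  have h1 := hw ψ hψ hc
  rw [isWeakDeriv_iterPartialDeriv l hf ψ hψ hc] at h1
  have h2 := mul_left_cancel₀ (by simp) h1
  simpa [mul_comm] using h2.symm

theorem iterPartialDeriv_replicate_append (i : Fin n) (m : ℕ) (l : List (Fin n))
    (f : Space n → ℝ) : iterPartialDeriv (List.replicate m i ++ l) f
      = (dirDeriv (EuclideanSpace.single i (1 : ℝ)))^[m] (iterPartialDeriv l f) := by
  induction m with
  | zero => rfl
  | succ m ih =>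
    rw [Function.iterate_succ_apply', ← ih, List.replicate_succ, List.cons_append,
      iterPartialDeriv_cons]

end Weak

/-! ### Functions on spacetime -/

section Slices

variable {n : ℕ}

/-- The coordinate vector `∂ₜ`. -/
def timeVec {n : ℕ} : Spacetime n := (1, 0)

/-- The coordinate vector `∂ᵢ`. -/
noncomputable def spaceVec {n : ℕ} (i : Fin n) : Spacetime n := (0, EuclideanSpace.single i 1)

theorem hasDerivAt_slice {F : Spacetime n → ℝ} (hF : ContDiff ℝ ∞ F) (t : ℝ) (x : Space n) :
    HasDerivAt (fun s => F (s, x)) (dirDeriv timeVec F (t, x)) t :=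
  ((hF.differentiable (by simp)) (t, x)).hasFDerivAt.comp_hasDerivAt t
    ((hasDerivAt_id t).prodMk (hasDerivAt_const t x))

theorem contDiff_slice {F : Spacetime n → ℝ} (hF : ContDiff ℝ ∞ F) (t : ℝ) :
    ContDiff ℝ ∞ fun x => F (t, x) :=
  hF.comp (contDiff_const.prodMk contDiff_id)

theorem dirDeriv_slice {F : Spacetime n → ℝ} (hF : ContDiff ℝ ∞ F) (t : ℝ) (i : Fin n) :
    dirDeriv (EuclideanSpace.single i (1 : ℝ)) (fun x => F (t, x))
      = fun x => dirDeriv (spaceVec i) F (t, x) := by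
  ext x
  have h := ((hF.differentiable (by simp)) (t, x)).hasFDerivAt.comp x
    ((hasFDerivAt_const t x).prodMk (hasFDerivAt_id x))
  change fderiv ℝ (F ∘ fun x => (t, x)) x _ = _
  erw [h.fderiv]
  simp [dirDeriv, spaceVec]

theorem iterate_dirDeriv_slice {F : Spacetime n → ℝ} (hF : ContDiff ℝ ∞ F) (t : ℝ) (i : Fin n)
    (m : ℕ) : (dirDeriv (EuclideanSpace.single i (1 : ℝ)))^[m] (fun x => F (t, x))
      = fun x => (dirDeriv (spaceVec i))^[m] F (t, x) := by
  induction m generalizing F with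
  | zero => rfl
  | succ m ih =>
    rw [Function.iterate_succ_apply, dirDeriv_slice hF, ih (contDiff_dirDeriv hF _),
      Function.iterate_succ_apply]

theorem hasCompactSupport_slice {F : Spacetime n → ℝ} {t r : ℝ}
    (h : ∀ x, r < ‖x‖ → F (t, x) = 0) : HasCompactSupport fun x => F (t, x) :=
  HasCompactSupport.of_support_subset_isCompact (isCompact_closedBall (0 : Space n) r)
    fun x hx => by
      by_contra hr
      exact hx (h x (by simpa using hr))

/-- Differentiation under the integral sign for integrands supported in a fixed ball. -/
theorem hasDerivAt_integral_slice {F : Spacetime n → ℝ} (hF : ContDiff ℝ ∞ F) {a r t : ℝ}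
    (hat : a < t) (h : ∀ s, a ≤ s → ∀ x, r < ‖x‖ → F (s, x) = 0) :
    HasDerivAt (fun s => ∫ x, F (s, x)) (∫ x, dirDeriv timeVec F (t, x)) t := by
  have hF' := contDiff_dirDeriv hF timeVec
  have hz : ∀ s, a < s → ∀ x, r < ‖x‖ → dirDeriv timeVec F (s, x) = 0 := by
    intro s hs x hx
    have h1 := hasDerivAt_slice hF s x
    have h2 : HasDerivAt (fun s => F (s, x)) 0 s := by
      refine (hasDerivAt_const s (0 : ℝ)).congr_of_eventuallyEq ?_
      filter_upwards [Ioi_mem_nhds hs] with u hu using h u (le_of_lt hu) x hx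
    exact h1.unique h2
  obtain ⟨c, hc⟩ := (isCompact_Icc.prod (isCompact_closedBall (0 : Space n) r)
    : IsCompact (Icc a (t + 1) ×ˢ _)).exists_bound_of_continuousOn hF'.continuous.continuousOn
  refine (hasDerivAt_integral_of_dominated_loc_of_deriv_le (s := Ioo a (t + 1))
    (bound := (Metric.closedBall (0 : Space n) r).indicator fun _ => c)
    (Ioo_mem_nhds hat (by linarith))
    (.of_forall fun s => (contDiff_slice hF s).continuous.aestronglyMeasurable)
    ((contDiff_slice hF t).continuous.integrable_of_hasCompactSupport
      (hasCompactSupport_slice (h t hat.le)))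
    (contDiff_slice hF' t).continuous.aestronglyMeasurable
    (.of_forall fun x s hs => ?_)
    ((integrable_indicator_iff measurableSet_closedBall).2
      (integrableOn_const (measure_closedBall_lt_top.ne)))
    (.of_forall fun x s hs => hasDerivAt_slice hF s x)).2
  by_cases hx : x ∈ Metric.closedBall (0 : Space n) r
  · rw [indicator_of_mem hx]
    exact hc (s, x) ⟨⟨hs.1.le, hs.2.le⟩, hx⟩
  · rw [indicator_of_notMem hx, hz s hs.1 x (by simpa using hx), norm_zero]

theorem dirDeriv_comp_fst {f : ℝ → ℝ} (hf : Differentiable ℝ f) (v : Spacetime n) :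
    dirDeriv v (fun p : Spacetime n => f p.1) = fun p => deriv f p.1 * v.1 := by
  ext p
  have := (hf p.1).hasDerivAt.comp_hasFDerivAt p
    (hasFDerivAt_fst (𝕜 := ℝ) (E := ℝ) (F := Space n) (p := p))
  change fderiv ℝ (f ∘ Prod.fst) p v = _
  rw [this.fderiv]
  simp

end Slices

/-! ### The energy estimate -/

section Energy

variable {n : ℕ}

/-- The wave equation `ψ_tt + n ψ_t = e^{-2t} Δψ` on `t ≥ t₀`. -/
def SolvesWave (t₀ : ℝ) (ψ : Spacetime n → ℝ) : Prop :=
  ∀ t, t₀ ≤ t → ∀ x, dirDeriv timeVec (dirDeriv timeVec ψ) (t, x)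
    + n * dirDeriv timeVec ψ (t, x)
      = Real.exp (-(2 * t)) * ∑ i, dirDeriv (spaceVec i) (dirDeriv (spaceVec i) ψ) (t, x)

/-- The coefficients of the equation depend on `t` only, so it commutes with `∂ⱼ`. -/
theorem SolvesWave.dirDeriv_spaceVec {t₀ : ℝ} {ψ : Spacetime n → ℝ} (h : SolvesWave t₀ ψ)
    (hψ : ContDiff ℝ ∞ ψ) (j : Fin n) : SolvesWave t₀ (dirDeriv (spaceVec j) ψ) := by
  intro t ht x
  have hd {f : Spacetime n → ℝ} (hf : ContDiff ℝ ∞ f) (v) := contDiff_dirDeriv hf v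
  have hS : ContDiff ℝ ∞ fun p : Spacetime n =>
      ∑ i, dirDeriv (spaceVec i) (dirDeriv (spaceVec i) ψ) p :=
    ContDiff.sum fun i _ => hd (hd hψ _) _
  have hL : ContDiff ℝ ∞ fun p : Spacetime n => (n : ℝ) * dirDeriv timeVec ψ p :=
    contDiff_const.mul (hd hψ _)
  -- The equation is differentiated along the slice of constant `t`: at `t = t₀` it is not known on
  -- a full neighbourhood in spacetime.
  have h1 := congrArg (fun f => dirDeriv (EuclideanSpace.single j (1 : ℝ)) f x)
    (funext (h t ht))
  rw [dirDeriv_slice ((hd (hd hψ timeVec) timeVec).add hL),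
    dirDeriv_mul contDiff_const (contDiff_slice hS t), dirDeriv_slice hS,
    dirDeriv_add (hd (hd hψ timeVec) timeVec) hL, dirDeriv_mul contDiff_const (hd hψ _),
    dirDeriv_sum _ fun i _ => hd (hd hψ _) _] at h1
  have hc : ∀ v w : Spacetime n, dirDeriv v (dirDeriv w (dirDeriv w ψ))
      = dirDeriv w (dirDeriv w (dirDeriv v ψ)) := fun v w => by
    rw [dirDeriv_comm (hd hψ w) v w, dirDeriv_comm hψ v w]
  beta_reduce at h1
  rw [hc (spaceVec j) timeVec, dirDeriv_comm hψ (spaceVec j) timeVec,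
    Finset.sum_congr rfl fun i _ => congrFun (hc (spaceVec j) (spaceVec i)) (t, x)] at h1
  simpa [dirDeriv] using h1

theorem SolvesWave.iterate_dirDeriv_spaceVec {t₀ : ℝ} {ψ : Spacetime n → ℝ}
    (h : SolvesWave t₀ ψ) (hψ : ContDiff ℝ ∞ ψ) (j : Fin n) (m : ℕ) :
    SolvesWave t₀ ((dirDeriv (spaceVec j))^[m] ψ) := by
  induction m generalizing ψ with
  | zero => exact h
  | succ m ih => exact ih (h.dirDeriv_spaceVec hψ j) (contDiff_dirDeriv hψ _)

/-- The energy density `e^{2t} ψ_t² + |∇ψ|²`. -/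
noncomputable def energyDensity (ψ : Spacetime n → ℝ) (p : Spacetime n) : ℝ :=
  Real.exp (2 * p.1) * (dirDeriv timeVec ψ p * dirDeriv timeVec ψ p)
    + ∑ i, dirDeriv (spaceVec i) ψ p * dirDeriv (spaceVec i) ψ p

theorem energyDensity_nonneg (ψ : Spacetime n → ℝ) (p : Spacetime n) : 0 ≤ energyDensity ψ p :=
  add_nonneg (mul_nonneg (Real.exp_pos _).le (mul_self_nonneg _))
    (Finset.sum_nonneg fun _ _ => mul_self_nonneg _)

theorem contDiff_energyDensity {ψ : Spacetime n → ℝ} (hψ : ContDiff ℝ ∞ ψ) :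
    ContDiff ℝ ∞ (energyDensity ψ) := by
  have hd (v) := contDiff_dirDeriv hψ v
  exact ((Real.contDiff_exp.comp (contDiff_const.mul contDiff_fst)).mul
    ((hd _).mul (hd _))).add (ContDiff.sum fun i _ => (hd _).mul (hd _))

/-- The weight `e^{2t}` cancels the `e^{-2t}` in front of the Laplacian, so that the sum is the
divergence of `ψ_t ∇ψ`. What remains combines the growth of the weight (`2`) and the damping
(`-2n`). -/
theorem dirDeriv_timeVec_energyDensity {t₀ : ℝ} {ψ : Spacetime n → ℝ} (h : SolvesWave t₀ ψ)
    (hψ : ContDiff ℝ ∞ ψ) {t : ℝ} (ht : t₀ ≤ t) (x : Space n) :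
    dirDeriv timeVec (energyDensity ψ) (t, x)
      = (2 - 2 * n) * Real.exp (2 * t) * dirDeriv timeVec ψ (t, x) ^ 2
        + 2 * ∑ i, (dirDeriv (spaceVec i) (dirDeriv timeVec ψ) (t, x)
            * dirDeriv (spaceVec i) ψ (t, x)
          + dirDeriv timeVec ψ (t, x) * dirDeriv (spaceVec i) (dirDeriv (spaceVec i) ψ) (t, x)) := by
  have hd (v) := contDiff_dirDeriv hψ v
  have he : Differentiable ℝ fun s : ℝ => Real.exp (2 * s) := by fun_prop
  have he' : ContDiff ℝ ∞ fun p : Spacetime n => Real.exp (2 * p.1) := by fun_prop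
  have hde : deriv (fun s : ℝ => Real.exp (2 * s)) t = 2 * Real.exp (2 * t) := by
    simp [mul_comm]
  unfold energyDensity
  rw [dirDeriv_add (he'.mul ((hd _).mul (hd _))) (ContDiff.sum fun i _ => (hd _).mul (hd _)),
    dirDeriv_mul he' ((hd _).mul (hd _)), dirDeriv_mul (hd _) (hd _),
    dirDeriv_comp_fst he, dirDeriv_sum _ fun i _ => (hd _).mul (hd _)]
  simp only [dirDeriv_mul (hd _) (hd _), hde, dirDeriv_comm hψ timeVec (spaceVec _)]
  have hw := h t ht x
  have hexp : Real.exp (2 * t) * Real.exp (-(2 * t)) = 1 := by rw [← Real.exp_add]; simp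
  rw [show dirDeriv timeVec (dirDeriv timeVec ψ) (t, x) = _ from eq_sub_of_add_eq hw]
  rw [Finset.sum_add_distrib, Finset.sum_add_distrib, ← Finset.mul_sum]
  simp only [timeVec, mul_comm (dirDeriv (spaceVec _) ψ (t, x))]
  linear_combination (2 * dirDeriv (1, 0) ψ (t, x) *
    ∑ i, dirDeriv (spaceVec i) (dirDeriv (spaceVec i) ψ) (t, x)) * hexp

/-- The argument of the cutoff, whose level sets are spacelike. -/
noncomputable def coneFun (R : ℝ) (p : Spacetime n) : ℝ :=
  R + Real.exp (-p.1) - √(1 + ‖p.2‖ ^ 2)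

theorem contDiff_coneFun (R : ℝ) : ContDiff ℝ ∞ (coneFun (n := n) R) := by
  have : ContDiff ℝ ∞ fun p : Spacetime n => √(1 + ‖p.2‖ ^ 2) :=
    ContDiff.sqrt (contDiff_const.add (contDiff_snd.norm_sq ℝ)) fun p => by positivity
  exact (contDiff_const.add (Real.contDiff_exp.comp contDiff_fst.neg)).sub this

theorem dirDeriv_coneFun (R : ℝ) (v p : Spacetime n) :
    dirDeriv v (coneFun R) p
      = -Real.exp (-p.1) * v.1 - inner ℝ p.2 v.2 / √(1 + ‖p.2‖ ^ 2) := by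
  have h1 : HasFDerivAt (fun p : Spacetime n => ‖p.2‖ ^ 2)
      ((2 • innerSL ℝ p.2).comp (ContinuousLinearMap.snd ℝ ℝ (Space n))) p :=
    (hasStrictFDerivAt_norm_sq p.2).hasFDerivAt.comp p hasFDerivAt_snd
  have h2 := (h1.const_add 1).sqrt (by positivity : (1 + ‖p.2‖ ^ 2 : ℝ) ≠ 0)
  have h3 : HasFDerivAt (fun p : Spacetime n => Real.exp (-p.1)) _ p :=
    (hasFDerivAt_fst (𝕜 := ℝ) (p := p)).neg.exp
  have h4 := (h3.const_add R).sub h2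
  unfold dirDeriv
  erw [h4.fderiv]
  simp
  field_simp

/-- The cutoff to a region shrinking faster than the speed of light. -/
noncomputable def coneCutoff (R : ℝ) (p : Spacetime n) : ℝ :=
  Real.smoothTransition (coneFun R p)

theorem contDiff_coneCutoff (R : ℝ) : ContDiff ℝ ∞ (coneCutoff (n := n) R) :=
  Real.smoothTransition.contDiff.comp (contDiff_coneFun R)

theorem dirDeriv_coneCutoff (R : ℝ) (v p : Spacetime n) :
    dirDeriv v (coneCutoff R) p
      = deriv Real.smoothTransition (coneFun R p) * dirDeriv v (coneFun R) p := by
  have h1 : DifferentiableAt ℝ Real.smoothTransition (coneFun R p) :=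
    (Real.smoothTransition.contDiff (n := 1)).differentiable (by simp) _
  have h2 := ((contDiff_coneFun (n := n) R).differentiable (by simp)) p
  have := h1.hasDerivAt.comp_hasFDerivAt p h2.hasFDerivAt
  unfold dirDeriv
  erw [this.fderiv]
  simp [coneFun]

theorem coneCutoff_eq_zero {R t₀ t : ℝ} (ht : t₀ ≤ t) {x : Space n}
    (hx : R + Real.exp (-t₀) < ‖x‖) : coneCutoff R (t, x) = 0 := by
  refine Real.smoothTransition.zero_of_nonpos ?_
  have h1 : Real.exp (-t) ≤ Real.exp (-t₀) := Real.exp_le_exp.2 (by linarith)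
  have h2 : ‖x‖ ≤ √(1 + ‖x‖ ^ 2) := Real.le_sqrt_of_sq_le (by linarith)
  simp only [coneFun]
  linarith

/-- Light has coordinate speed `e^{-t}`, the rate at which `R + e^{-t}` decreases, while the spatial
gradient `x / √(1 + |x|²)` of the subtracted term has length at most `1`. Hence the energy flux
through the level sets of the cutoff has a sign. -/
theorem coneCutoff_flux_nonpos (R : ℝ) (ψ : Spacetime n → ℝ) (p : Spacetime n) :
    dirDeriv timeVec (coneCutoff R) p * energyDensity ψ p
      - 2 * ∑ i, dirDeriv (spaceVec i) (coneCutoff R) p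
        * (dirDeriv timeVec ψ p * dirDeriv (spaceVec i) ψ p) ≤ 0 := by
  obtain ⟨t, x⟩ := p
  set P := dirDeriv timeVec ψ (t, x) with hP
  set σ := deriv Real.smoothTransition (coneFun R (t, x)) with hσ
  have hσ0 : 0 ≤ σ := Real.smoothTransition.monotone.deriv_nonneg
  set N := √(1 + ‖x‖ ^ 2) with hN
  have hN0 : 0 < N := by positivity
  have hb : ∑ i, (x i / N) ^ 2 ≤ 1 := by
    simp only [div_pow]
    rw [← Finset.sum_div, div_le_one (by positivity), hN, Real.sq_sqrt (by positivity),
      EuclideanSpace.norm_sq_eq]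
    simp
  have hE : Real.exp (-t) * Real.exp (2 * t) = Real.exp t := by
    rw [← Real.exp_add]; congr 1; ring
  have hE2 : Real.exp (-t) * Real.exp t = 1 := by rw [← Real.exp_add]; simp
  have hE3 : Real.exp (-t) * Real.exp t ^ 2 = Real.exp t := by rw [sq, ← mul_assoc, hE2, one_mul]
  have key : 0 ≤ Real.exp (-t) * energyDensity ψ (t, x)
      - 2 * ∑ i, x i / N * (P * dirDeriv (spaceVec i) ψ (t, x)) := by
    -- Completing the square in each `∂ᵢψ`; the leftover multiple of `ψ_t²` is nonnegative because
    -- `∑ (xᵢ / N)² ≤ 1`.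
    have e : Real.exp (-t) * energyDensity ψ (t, x)
        - 2 * ∑ i, x i / N * (P * dirDeriv (spaceVec i) ψ (t, x))
        = Real.exp t * P ^ 2 * (1 - ∑ i, (x i / N) ^ 2)
          + ∑ i, Real.exp (-t)
            * (dirDeriv (spaceVec i) ψ (t, x) - Real.exp t * (x i / N) * P) ^ 2 := by
      have : ∀ i, Real.exp (-t)
            * (dirDeriv (spaceVec i) ψ (t, x) - Real.exp t * (x i / N) * P) ^ 2
          = Real.exp (-t) * (dirDeriv (spaceVec i) ψ (t, x) * dirDeriv (spaceVec i) ψ (t, x))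
            - 2 * (x i / N * (P * dirDeriv (spaceVec i) ψ (t, x)))
            + Real.exp t * P ^ 2 * (x i / N) ^ 2 := by
        intro i
        linear_combination (-2 * dirDeriv (spaceVec i) ψ (t, x) * (x i / N) * P) * hE2
          + (x i / N) ^ 2 * P ^ 2 * hE3
      simp only [this, Finset.sum_add_distrib, Finset.sum_sub_distrib, ← Finset.mul_sum,
        energyDensity, ← hP]
      linear_combination P * P * hE
    rw [e]
    have : 0 ≤ 1 - ∑ i, (x i / N) ^ 2 := by linarith
    positivity
  have e : dirDeriv timeVec (coneCutoff R) (t, x) * energyDensity ψ (t, x)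
      - 2 * ∑ i, dirDeriv (spaceVec i) (coneCutoff R) (t, x)
        * (P * dirDeriv (spaceVec i) ψ (t, x))
      = -(σ * (Real.exp (-t) * energyDensity ψ (t, x)
      - 2 * ∑ i, x i / N * (P * dirDeriv (spaceVec i) ψ (t, x)))) := by
    have ht : dirDeriv timeVec (coneCutoff R) (t, x) = -(σ * Real.exp (-t)) := by
      simp [dirDeriv_coneCutoff, dirDeriv_coneFun, ← hσ, timeVec]
    have hx : ∀ i, dirDeriv (spaceVec i) (coneCutoff R) (t, x) = -(σ * (x i / N)) := fun i => by
      simp [dirDeriv_coneCutoff, dirDeriv_coneFun, ← hσ, spaceVec, ← hN,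
        EuclideanSpace.inner_single_right]
    have hs : ∑ i, -(σ * (x i / N)) * (P * dirDeriv (spaceVec i) ψ (t, x))
        = -(σ * ∑ i, x i / N * (P * dirDeriv (spaceVec i) ψ (t, x))) := by
      rw [Finset.mul_sum, ← Finset.sum_neg_distrib]
      exact Finset.sum_congr rfl fun i _ => by ring
    simp only [ht, hx, hs]
    ring
  rw [e]
  exact neg_nonpos.2 (mul_nonneg hσ0 key)

/-- The time derivative of the integrand is at most twice the divergence of the compactly supported
field `coneCutoff · ψ_t ∇ψ`, whose integral vanishes. -/
theorem antitoneOn_integral_energyDensity (hn : 1 ≤ n) {t₀ : ℝ} {ψ : Spacetime n → ℝ}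
    (h : SolvesWave t₀ ψ) (hψ : ContDiff ℝ ∞ ψ) (R : ℝ) :
    AntitoneOn (fun t => ∫ x, coneCutoff R (t, x) * energyDensity ψ (t, x)) (Ici t₀) := by
  have hd (v) := contDiff_dirDeriv hψ v
  have hw := contDiff_coneCutoff (n := n) R
  have he := contDiff_energyDensity hψ
  have hF : ContDiff ℝ ∞ fun p : Spacetime n => coneCutoff R p * energyDensity ψ p := hw.mul he
  have hder : ∀ t, t₀ ≤ t → HasDerivAt
      (fun t => ∫ x, coneCutoff R (t, x) * energyDensity ψ (t, x))
      (∫ x, dirDeriv timeVec (fun p => coneCutoff R p * energyDensity ψ p) (t, x)) t := by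
    intro t ht
    -- The derivative is two-sided, also at `t₀`, so the common ball containing the supports is
    -- chosen from an earlier time; the support of the cutoff shrinks as `t` grows.
    exact hasDerivAt_integral_slice hF (a := t₀ - 1) (r := R + Real.exp (-(t₀ - 1)))
      (by linarith) fun s hs x hx => by rw [coneCutoff_eq_zero hs hx, zero_mul]
  refine antitoneOn_of_deriv_nonpos (convex_Ici t₀)
    (fun t ht => (hder t ht).continuousAt.continuousWithinAt)
    (fun t ht => (hder t (interior_subset ht)).differentiableAt.differentiableWithinAt)
    fun t ht => ?_
  replace ht : t₀ ≤ t := interior_subset ht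
  rw [(hder t ht).deriv]
  let G : Fin n → Spacetime n → ℝ := fun i p =>
    coneCutoff R p * (dirDeriv timeVec ψ p * dirDeriv (spaceVec i) ψ p)
  have hG : ∀ i, ContDiff ℝ ∞ (G i) := fun i => hw.mul ((hd _).mul (hd _))
  have hGc : ∀ i, HasCompactSupport fun x => G i (t, x) := fun i =>
    hasCompactSupport_slice (r := R + Real.exp (-t)) fun x hx => by
      simp only [G, coneCutoff_eq_zero le_rfl hx, zero_mul]
  have hG0 : ∀ i, ∫ x, dirDeriv (spaceVec i) (G i) (t, x) = 0 := fun i => by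
    rw [← dirDeriv_slice (hG i)]
    exact integral_dirDeriv_eq_zero (contDiff_slice (hG i) t) (hGc i) _
  have hGi : ∀ i, Integrable fun x => dirDeriv (spaceVec i) (G i) (t, x) := fun i => by
    rw [← dirDeriv_slice (hG i)]
    exact (contDiff_dirDeriv (contDiff_slice (hG i) t) _).continuous.integrable_of_hasCompactSupport
      (hasCompactSupport_dirDeriv (hGc i) _)
  have hle : ∀ x, dirDeriv timeVec (fun p => coneCutoff R p * energyDensity ψ p) (t, x)
      ≤ 2 * ∑ i, dirDeriv (spaceVec i) (G i) (t, x) := by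
    intro x
    have hflux := coneCutoff_flux_nonpos R ψ (t, x)
    rw [dirDeriv_mul hw he]
    simp only [G, dirDeriv_mul hw ((hd _).mul (hd _)), dirDeriv_mul (hd _) (hd _)]
    rw [Finset.sum_add_distrib, ← Finset.mul_sum, dirDeriv_timeVec_energyDensity h hψ ht]
    have hn' : (1 : ℝ) ≤ n := by exact_mod_cast hn
    have h0 : 0 ≤ coneCutoff R (t, x) * ((2 * n - 2) * Real.exp (2 * t)
        * dirDeriv timeVec ψ (t, x) ^ 2) := by
      refine mul_nonneg (Real.smoothTransition.nonneg _) ?_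
      have : (0 : ℝ) ≤ 2 * n - 2 := by linarith
      positivity
    linarith
  -- If the integrand is not integrable, its integral is `0` by convention and the inequality is
  -- trivial, so integrability need not be proved.
  by_cases hi : Integrable fun x =>
      dirDeriv timeVec (fun p => coneCutoff R p * energyDensity ψ p) (t, x)
  · refine (integral_mono hi ((integrable_finsetSum _ fun i _ => hGi i).const_mul 2) hle).trans ?_
    rw [integral_const_mul, integral_finsetSum _ fun i _ => hGi i]
    simp [hG0]
  · rw [integral_undef hi]

/-- The gradient of a solution with finite initial energy is bounded in `L²`, uniformly in time. -/
theorem exists_setIntegral_sq_le (hn : 1 ≤ n) {t₀ : ℝ} {ψ : Spacetime n → ℝ}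
    (h : SolvesWave t₀ ψ) (hψ : ContDiff ℝ ∞ ψ)
    (ht : MemLp (fun x => dirDeriv timeVec ψ (t₀, x)) 2)
    (hx : ∀ i, MemLp (fun x => dirDeriv (spaceVec i) ψ (t₀, x)) 2) :
    ∃ M : ℝ, 0 ≤ M ∧ ∀ t, t₀ ≤ t → ∀ (x₀ : Space n) (i : Fin n),
      ∫ x in Metric.closedBall x₀ 1, dirDeriv (spaceVec i) ψ (t, x) ^ 2 ≤ M := by
  have hint : Integrable fun x => energyDensity ψ (t₀, x) := by
    unfold energyDensity
    simp only [← sq]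
    exact (ht.integrable_sq.const_mul _).add
      (integrable_finsetSum _ fun i _ => (hx i).integrable_sq)
  refine ⟨∫ x, energyDensity ψ (t₀, x), integral_nonneg fun x => energyDensity_nonneg _ _,
    fun t htt x₀ i => ?_⟩
  -- Large enough for the cutoff to equal `1` on the unit ball about `x₀` at every time, as `e^{-t}
  -- > 0`. The final bound does not see `R`, because the cutoff is at most `1` at time `t₀`.
  obtain ⟨R, hR⟩ : ∃ R : ℝ, R = 1 + √(1 + (‖x₀‖ + 1) ^ 2) := ⟨_, rfl⟩
  have hw1 : ∀ x ∈ Metric.closedBall x₀ 1, coneCutoff R (t, x) = 1 := by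
    intro x hx
    refine Real.smoothTransition.one_of_one_le ?_
    have h1 : ‖x‖ ≤ ‖x₀‖ + 1 := by
      have h2 : ‖x - x₀‖ ≤ 1 := by simpa [dist_eq_norm] using hx
      have := norm_le_norm_add_norm_sub' x x₀
      linarith
    have h2 : √(1 + ‖x‖ ^ 2) ≤ √(1 + (‖x₀‖ + 1) ^ 2) := by gcongr
    have := Real.exp_pos (-t)
    simp only [coneFun, hR]
    linarith
  have hcont (s : ℝ) : Continuous fun x => coneCutoff R (s, x) * energyDensity ψ (s, x) :=
    (contDiff_slice ((contDiff_coneCutoff R).mul (contDiff_energyDensity hψ)) s).continuous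
  have hwe (s : ℝ) : Integrable fun x => coneCutoff R (s, x) * energyDensity ψ (s, x) := by
    refine (hcont s).integrable_of_hasCompactSupport (HasCompactSupport.mul_right
      (hasCompactSupport_slice (F := coneCutoff R) fun x hx => coneCutoff_eq_zero le_rfl hx))
  have hnn (s : ℝ) (x) : 0 ≤ coneCutoff R (s, x) * energyDensity ψ (s, x) :=
    mul_nonneg (Real.smoothTransition.nonneg _) (energyDensity_nonneg _ _)
  calc ∫ x in Metric.closedBall x₀ 1, dirDeriv (spaceVec i) ψ (t, x) ^ 2
      ≤ ∫ x in Metric.closedBall x₀ 1, coneCutoff R (t, x) * energyDensity ψ (t, x) := by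
        refine setIntegral_mono_on
          (((contDiff_slice (contDiff_dirDeriv hψ _) t).continuous.pow 2).continuousOn.integrableOn_compact
            (isCompact_closedBall x₀ 1)) (hwe t).integrableOn
          measurableSet_closedBall fun x hx => ?_
        rw [hw1 x hx, one_mul, sq]
        refine (Finset.single_le_sum (f := fun i => dirDeriv (spaceVec i) ψ (t, x)
          * dirDeriv (spaceVec i) ψ (t, x)) (fun i _ => mul_self_nonneg _)
          (Finset.mem_univ i)).trans ?_
        exact le_add_of_nonneg_left (mul_nonneg (Real.exp_pos _).le (mul_self_nonneg _))
    _ ≤ ∫ x, coneCutoff R (t, x) * energyDensity ψ (t, x) :=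
        setIntegral_le_integral (hwe t) (.of_forall (hnn t))
    _ ≤ ∫ x, coneCutoff R (t₀, x) * energyDensity ψ (t₀, x) :=
        antitoneOn_integral_energyDensity hn h hψ R self_mem_Ici htt htt
    _ ≤ ∫ x, energyDensity ψ (t₀, x) := by
        refine integral_mono (hwe t₀) hint fun x => ?_
        exact mul_le_of_le_one_left (energyDensity_nonneg _ _) (Real.smoothTransition.le_one _)

end Energy

/-! ### The wave operator of the de Sitter metric -/

section WaveOperator

open Filter Topology

variable {n : ℕ}

theorem sqrt_neg_det_metric (q : Spacetime n) :
    √(-(metric n q).det) = Real.exp (n * q.1) := by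
  rw [metric, Matrix.det_diagonal, Fin.prod_univ_succ]
  simp only [Fin.cons_zero, Fin.cons_succ, Finset.prod_const, Finset.card_univ, Fintype.card_fin,
    scaleFactor]
  rw [neg_one_mul, neg_neg, ← pow_mul, mul_comm 2 n, pow_mul, Real.sqrt_sq (by positivity),
    ← Real.exp_nat_mul]

theorem inv_metric (q : Spacetime n) :
    (metric n q)⁻¹ = Matrix.diagonal (Fin.cons (-1) fun _ => Real.exp (-(2 * q.1))) := by
  refine Matrix.inv_eq_right_inv ?_
  rw [metric, Matrix.diagonal_mul_diagonal, ← Matrix.diagonal_one]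
  congr 1
  ext i
  refine Fin.cases ?_ (fun i => ?_) i
  · simp
  · simp only [Fin.cons_succ, scaleFactor]
    rw [sq, ← Real.exp_add, ← Real.exp_add, ← two_mul, add_neg_cancel, Real.exp_zero]

/-- The volume factor `e^{nt}` cancels except where `∂ₜ` hits it, which produces the damping term `n
u_t`. -/
theorem dAlembertian_metric {u : Spacetime n → ℝ} (hu : ContDiff ℝ ∞ u) (p : Spacetime n) :
    dAlembertian (metric n) u p = -dirDeriv timeVec (dirDeriv timeVec u) p
      - n * dirDeriv timeVec u p
      + Real.exp (-(2 * p.1)) * ∑ i, dirDeriv (spaceVec i) (dirDeriv (spaceVec i) u) p := by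
  have hd (v) := contDiff_dirDeriv hu v
  have hexp (c : ℝ) : ContDiff ℝ ∞ fun q : Spacetime n => Real.exp (c * q.1) := by fun_prop
  have hder (c : ℝ) (v : Spacetime n) : dirDeriv v (fun q : Spacetime n => Real.exp (c * q.1))
      = fun q => c * Real.exp (c * q.1) * v.1 := by
    rw [dirDeriv_comp_fst (f := fun s => Real.exp (c * s)) (by fun_prop)]
    ext q
    have h : HasDerivAt (fun s => Real.exp (c * s)) (c * Real.exp (c * q.1)) q.1 := by
      simpa [mul_comm] using! ((hasDerivAt_id q.1).const_mul c).exp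
    simp only [h.deriv]
  have h0 : dirDeriv timeVec (fun q => Real.exp (n * q.1) * (-1 * dirDeriv timeVec u q)) p
      = Real.exp (n * p.1) * (-dirDeriv timeVec (dirDeriv timeVec u) p
        - n * dirDeriv timeVec u p) := by
    rw [dirDeriv_mul (hexp n) (contDiff_const.mul (hd _)), dirDeriv_mul contDiff_const (hd _),
      hder]
    simp only [dirDeriv, timeVec, fderiv_fun_const]
    simp
    ring
  have h1 : ∀ i, dirDeriv (spaceVec i) (fun q => Real.exp (n * q.1)
        * (Real.exp (-2 * q.1) * dirDeriv (spaceVec i) u q)) p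
      = Real.exp (n * p.1) * (Real.exp (-(2 * p.1))
        * dirDeriv (spaceVec i) (dirDeriv (spaceVec i) u) p) := by
    intro i
    rw [dirDeriv_mul (hexp n) ((hexp (-2)).mul (hd _)), dirDeriv_mul (hexp (-2)) (hd _),
      hder, hder]
    simp [spaceVec]
  unfold dAlembertian
  simp only [sqrt_neg_det_metric, inv_metric, Matrix.diagonal_apply, ite_mul, zero_mul,
    Finset.sum_ite_eq, Finset.mem_univ, if_true, Fin.sum_univ_succ, Fin.cons_zero, Fin.cons_succ]
  rw [inv_mul_eq_iff_eq_mul₀ (Real.exp_pos _).ne', mul_add, Finset.mul_sum, Finset.mul_sum]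
  simp only [← neg_mul] at h1 ⊢
  exact congrArg₂ _ h0 (Finset.sum_congr rfl fun i _ => h1 i)

theorem dAlembertian_congr {g : Spacetime n → Matrix (Fin (n + 1)) (Fin (n + 1)) ℝ}
    {φ u : Spacetime n → ℝ} {p : Spacetime n} (h : φ =ᶠ[𝓝 p] u) :
    dAlembertian g φ p = dAlembertian g u p := by
  unfold dAlembertian
  congr 1
  refine Finset.sum_congr rfl fun μ _ => ?_
  unfold coordDeriv
  refine congrArg (fun L : Spacetime n →L[ℝ] ℝ => L (coordVec μ)) (Filter.EventuallyEq.fderiv_eq ?_)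
  filter_upwards [h.fderiv (𝕜 := ℝ)] with q hq
  simp only [hq]

/-- Multiplication by a cutoff in time, vanishing before `a` and equal to `1` after `b`, where
`tstar < a < b < t₀`. The analysis can then assume global smoothness, and agreement starts strictly
before `t₀`, so derivatives at `t₀` agree as well. -/
theorem exists_contDiff_eq_of_contDiffOn {φ : Spacetime n → ℝ} {tstar t₀ : ℝ} (ht : tstar < t₀)
    (hφ : ContDiffOn ℝ ∞ φ (Ioi tstar ×ˢ univ)) :
    ∃ u : Spacetime n → ℝ, ContDiff ℝ ∞ u ∧ ∃ t₁ < t₀, ∀ t, t₁ < t → ∀ x, φ (t, x) = u (t, x) := by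
  obtain ⟨a, ha, hat⟩ := exists_between ht
  obtain ⟨b, hab, hbt⟩ := exists_between hat
  have hba : 0 < b - a := by linarith
  have hη : ContDiff ℝ ∞ fun p : Spacetime n => Real.smoothTransition ((p.1 - a) / (b - a)) :=
    Real.smoothTransition.contDiff.comp ((contDiff_fst.sub contDiff_const).div_const _)
  refine ⟨fun p => Real.smoothTransition ((p.1 - a) / (b - a)) * φ p, ?_, b, hbt,
    fun t hbt x => ?_⟩
  · refine contDiff_iff_contDiffAt.2 fun p => ?_
    by_cases hp : tstar < p.1
    · exact hη.contDiffAt.mul (hφ.contDiffAt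
        ((isOpen_Ioi.prod isOpen_univ).mem_nhds ⟨hp, mem_univ _⟩))
    · refine (contDiffAt_const (c := (0 : ℝ))).congr_of_eventuallyEq ?_
      have : ∀ᶠ q : Spacetime n in 𝓝 p, q.1 < a :=
        continuous_fst.continuousAt.eventually_lt_const (by linarith)
      filter_upwards [this] with q hq
      rw [Real.smoothTransition.zero_of_nonpos, zero_mul]
      exact div_nonpos_of_nonpos_of_nonneg (by linarith) hba.le
  · simp only
    rw [Real.smoothTransition.one_of_one_le, one_mul]
    rw [one_le_div hba]
    linarith

end WaveOperator

/-! ### Decay of the time derivative -/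

/-- With the integrating factor `e^{νs}`, the source bounded by `K e^{(ν-2)s}` has primitive `K / (ν
- 2) · e^{(ν-2)s}`. Subtracting it leaves a nonincreasing function. -/
theorem le_mul_exp_of_hasDerivAt {ν t₀ K K₀ : ℝ} (hν : 2 < ν) (hK₀ : 0 ≤ K₀) (hK : 0 ≤ K)
    {P P' L : ℝ → ℝ} (hP : ∀ t, t₀ ≤ t → HasDerivAt P (P' t) t)
    (heq : ∀ t, t₀ ≤ t → P' t + ν * P t = Real.exp (-(2 * t)) * L t)
    (hL : ∀ t, t₀ ≤ t → L t ≤ K) (h0 : P t₀ ≤ K₀) {t : ℝ} (ht : t₀ ≤ t) :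
    P t ≤ (Real.exp (2 * t₀) * K₀ + K / (ν - 2)) * Real.exp (-(2 * t)) := by
  have hν' : 0 < ν - 2 := by linarith
  have hexp (c s : ℝ) : HasDerivAt (fun s => Real.exp (c * s)) (c * Real.exp (c * s)) s := by
    simpa [mul_comm] using! ((hasDerivAt_id s).const_mul c).exp
  have hf : ∀ s, t₀ ≤ s → HasDerivAt
      (fun s => Real.exp (ν * s) * P s - K / (ν - 2) * Real.exp ((ν - 2) * s))
      (Real.exp ((ν - 2) * s) * (L s - K)) s := by
    intro s hs
    refine (((hexp ν s).mul (hP s hs)).sub ((hexp (ν - 2) s).const_mul (K / (ν - 2)))).congr_deriv ?_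
    have e1 : Real.exp ((ν - 2) * s) = Real.exp (ν * s) * Real.exp (-(2 * s)) := by
      rw [← Real.exp_add]; congr 1; ring
    have e2 : K / (ν - 2) * ((ν - 2) * Real.exp ((ν - 2) * s)) = K * Real.exp ((ν - 2) * s) := by
      field_simp
    rw [e2, e1]
    linear_combination Real.exp (ν * s) * heq s hs
  have hanti : AntitoneOn
      (fun s => Real.exp (ν * s) * P s - K / (ν - 2) * Real.exp ((ν - 2) * s)) (Ici t₀) := by
    refine antitoneOn_of_deriv_nonpos (convex_Ici t₀)
      (fun s hs => (hf s hs).continuousAt.continuousWithinAt)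
      (fun s hs => (hf s (interior_subset hs)).differentiableAt.differentiableWithinAt)
      fun s hs => ?_
    have hs' : t₀ ≤ s := interior_subset hs
    rw [(hf s hs').deriv]
    exact mul_nonpos_of_nonneg_of_nonpos (Real.exp_pos _).le (by linarith [hL s hs'])
  have h1 := hanti self_mem_Ici ht ht
  simp only at h1
  have h2 : 0 ≤ K / (ν - 2) * Real.exp ((ν - 2) * t₀) := by positivity
  have h3 : Real.exp (ν * t₀) * P t₀ ≤ Real.exp (ν * t₀) * K₀ := by gcongr
  have h4 : Real.exp (ν * t₀) * K₀
      ≤ Real.exp (ν * t) * (Real.exp (2 * t₀) * K₀ * Real.exp (-(2 * t))) := by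
    -- In exponents this is `(ν - 2) (t - t₀) ≥ 0`: the initial value decays at least like
    -- `e^{-2t}`.
    have : Real.exp (ν * t₀) ≤ Real.exp (ν * t) * Real.exp (2 * t₀) * Real.exp (-(2 * t)) := by
      rw [← Real.exp_add, ← Real.exp_add]
      refine Real.exp_le_exp.2 ?_
      nlinarith
    calc _ ≤ Real.exp (ν * t) * Real.exp (2 * t₀) * Real.exp (-(2 * t)) * K₀ := by gcongr
      _ = _ := by ring
  have h5 : Real.exp ((ν - 2) * t) = Real.exp (ν * t) * Real.exp (-(2 * t)) := by
    rw [← Real.exp_add]; congr 1; ring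
  rw [h5] at h1
  refine le_of_mul_le_mul_left ?_ (Real.exp_pos (ν * t))
  linarith

/-- The second derivatives `∂ⱼ ∂ⱼ u` of a smooth solution with data in `H^{s+2} × H^{s+1}`,
`s > n / 2`, are uniformly bounded. -/
theorem exists_abs_dirDeriv_dirDeriv_le {n s : ℕ} (hs : n < 2 * s) {t₀ : ℝ}
    {u : Spacetime n → ℝ} (hu : ContDiff ℝ ∞ u) (hwave : SolvesWave t₀ u)
    (h₀ : MemH (s + 2) fun x => u (t₀, x))
    (h₁ : MemH (s + 1) fun x => dirDeriv timeVec u (t₀, x)) (j : Fin n) :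
    ∃ K : ℝ, ∀ t, t₀ ≤ t → ∀ x, |dirDeriv (spaceVec j) (dirDeriv (spaceVec j) u) (t, x)| ≤ K := by
  have hn : 1 ≤ n := Nat.one_le_iff_ne_zero.2 fun h => by subst h; exact j.elim0
  have hd (v) := contDiff_dirDeriv hu v
  -- The energy of `ψ i m` controls `∂ⱼ (ψ i m) = ∂ᵢ^m (∂ⱼ² u)`. Its initial value involves `m + 1 ≤
  -- s + 1` derivatives of `u_t` and `m + 2 ≤ s + 2` derivatives of `u`.
  let ψ : Fin n → ℕ → Spacetime n → ℝ := fun i m =>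
    (dirDeriv (spaceVec i))^[m] (dirDeriv (spaceVec j) u)
  have hψ : ∀ i m, ContDiff ℝ ∞ (ψ i m) := fun i m => contDiff_iterate_dirDeriv (hd _) _ m
  have hslice : ∀ F : Spacetime n → ℝ, ContDiff ℝ ∞ F → ∀ (i : Fin n) (m : ℕ),
      iterPartialDeriv (List.replicate m i ++ [j]) (fun x => F (t₀, x))
        = fun x => (dirDeriv (spaceVec i))^[m] (dirDeriv (spaceVec j) F) (t₀, x) := by
    intro F hF i m
    rw [iterPartialDeriv_replicate_append, iterPartialDeriv_cons]
    change (dirDeriv _)^[m] (dirDeriv _ fun x => F (t₀, x)) = _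
    rw [dirDeriv_slice hF, iterate_dirDeriv_slice (contDiff_dirDeriv hF _)]
  have hex : ∀ i : Fin n, ∀ m : ℕ, ∃ M : ℝ, 0 ≤ M ∧ (m ≤ s → ∀ t, t₀ ≤ t → ∀ x₀ : Space n,
      ∫ x in Metric.closedBall x₀ 1, dirDeriv (spaceVec j) (ψ i m) (t, x) ^ 2 ≤ M) := by
    intro i m
    by_cases hm : m ≤ s
    swap
    -- A default value for `m > s`, so that `M` can be chosen as a total function of `m`.
    · exact ⟨0, le_rfl, fun h => absurd h hm⟩
    have ht : MemLp (fun x => dirDeriv timeVec (ψ i m) (t₀, x)) 2 := by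
      have h := h₁.memLp_iterPartialDeriv (contDiff_slice (hd _) t₀)
        (l := List.replicate m i ++ [j]) (by simpa using hm)
      rw [hslice _ (hd _)] at h
      simp only [ψ, dirDeriv_iterate_comm (hd _), dirDeriv_comm hu timeVec]
      exact h
    have hx : ∀ l, MemLp (fun x => dirDeriv (spaceVec l) (ψ i m) (t₀, x)) 2 := by
      intro l
      have h := h₀.memLp_iterPartialDeriv (contDiff_slice hu t₀)
        (l := l :: (List.replicate m i ++ [j])) (by simpa using hm)
      rw [iterPartialDeriv_cons, hslice _ hu] at h
      change MemLp (dirDeriv _ fun x => ψ i m (t₀, x)) 2 volume at h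
      rw [dirDeriv_slice (hψ i m)] at h
      exact h
    obtain ⟨M, hM, hb⟩ := exists_setIntegral_sq_le hn
      ((hwave.dirDeriv_spaceVec hu j).iterate_dirDeriv_spaceVec (hd _) i m) (hψ i m) ht hx
    exact ⟨M, hM, fun _ t ht x₀ => hb t ht x₀ j⟩
  choose M hM hMb using hex
  obtain ⟨C, hC⟩ := exists_abs_le_of_forall_setIntegral_le hs
  have hle : ∀ i, ∀ m ≤ s, M i m ≤ ∑ i, ∑ m ∈ Finset.range (s + 1), M i m := by
    intro i m hm
    refine (Finset.single_le_sum (f := fun m => M i m) (fun m _ => hM i m)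
      (Finset.mem_range.2 (Nat.lt_succ_of_le hm))).trans ?_
    exact Finset.single_le_sum (f := fun i => ∑ m ∈ Finset.range (s + 1), M i m)
      (fun i _ => Finset.sum_nonneg fun m _ => hM i m) (Finset.mem_univ i)
  refine ⟨C * (1 + ∑ i, ∑ m ∈ Finset.range (s + 1), M i m), fun t ht x₀ => ?_⟩
  have hjj := contDiff_dirDeriv (hd (spaceVec j)) (spaceVec j)
  refine hC _ (contDiff_slice hjj t) _
    (Finset.sum_nonneg fun i _ => Finset.sum_nonneg fun m _ => hM i m) x₀ (fun i m hm => ?_) ?_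
  · rw [iterate_dirDeriv_slice hjj, ← dirDeriv_iterate_comm (hd _)]
    exact (hMb i m hm t ht x₀).trans (hle i m hm)
  · exact (hMb j 0 (Nat.zero_le s) t ht x₀).trans (hle j 0 (Nat.zero_le s))

/-- Needed for the initial value of `u_t` in the ODE argument; the local Sobolev inequality applies
with global `L²` norms as the bound. -/
theorem MemH.exists_abs_le {n s : ℕ} (hs : n < 2 * s) {f : Space n → ℝ} (h : MemH s f)
    (hf : ContDiff ℝ ∞ f) : ∃ K : ℝ, ∀ x, |f x| ≤ K := by
  obtain ⟨C, hC⟩ := exists_abs_le_of_forall_setIntegral_le hs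
  have hLp : ∀ (i : Fin n) (m : ℕ), m ≤ s →
      MemLp ((dirDeriv (EuclideanSpace.single i (1 : ℝ)))^[m] f) 2 := by
    intro i m hm
    have := h.memLp_iterPartialDeriv hf (l := List.replicate m i ++ []) (by simpa using hm)
    rwa [iterPartialDeriv_replicate_append] at this
  let M : Fin n → ℕ → ℝ := fun i m =>
    ∫ x, ((dirDeriv (EuclideanSpace.single i (1 : ℝ)))^[m] f x) ^ 2
  have hM : ∀ i m, 0 ≤ M i m := fun i m => integral_nonneg fun x => sq_nonneg _
  have hM₀ : 0 ≤ ∫ x, f x ^ 2 := integral_nonneg fun x => sq_nonneg _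
  have hle : ∀ i, ∀ m ≤ s, M i m ≤ ∑ i, ∑ m ∈ Finset.range (s + 1), M i m := by
    intro i m hm
    refine (Finset.single_le_sum (f := fun m => M i m) (fun m _ => hM i m)
      (Finset.mem_range.2 (Nat.lt_succ_of_le hm))).trans ?_
    exact Finset.single_le_sum (f := fun i => ∑ m ∈ Finset.range (s + 1), M i m)
      (fun i _ => Finset.sum_nonneg fun m _ => hM i m) (Finset.mem_univ i)
  have hsum : 0 ≤ ∑ i, ∑ m ∈ Finset.range (s + 1), M i m :=
    Finset.sum_nonneg fun i _ => Finset.sum_nonneg fun m _ => hM i m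
  refine ⟨C * (1 + ((∫ x, f x ^ 2) + ∑ i, ∑ m ∈ Finset.range (s + 1), M i m)), fun x₀ =>
    hC f hf _ (by positivity) x₀ (fun i m hm => ?_) ?_⟩
  · refine (setIntegral_le_integral (hLp i m hm).integrable_sq
      (.of_forall fun x => sq_nonneg _)).trans ?_
    have := hle i m hm
    simp only [M] at this ⊢
    linarith
  · refine (setIntegral_le_integral h.1.integrable_sq (.of_forall fun x => sq_nonneg _)).trans ?_
    linarith

theorem MemH.mono {n k l : ℕ} (hkl : k ≤ l) {f : Space n → ℝ} (h : MemH l f) : MemH k f :=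
  ⟨h.1, fun i hi => h.2 i (hi.trans hkl)⟩

/-- Decay of the time derivative of a globally smooth function solving the wave equation for
`t ≥ t₀`. -/
theorem SolvesWave.exists_abs_dirDeriv_timeVec_le {n s : ℕ} (hn : 2 < n) (hs : n < 2 * s) {t₀ : ℝ}
    {u : Spacetime n → ℝ} (hu : ContDiff ℝ ∞ u) (hwave : SolvesWave t₀ u)
    (h₀ : MemH (s + 2) fun x => u (t₀, x))
    (h₁ : MemH (s + 1) fun x => dirDeriv timeVec u (t₀, x)) :
    ∃ C : ℝ, ∀ t, t₀ ≤ t → ∀ x, |dirDeriv timeVec u (t, x)| ≤ C * Real.exp (-(2 * t)) := by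
  have hd (v) := contDiff_dirDeriv hu v
  choose K hK using exists_abs_dirDeriv_dirDeriv_le hs hu hwave h₀ h₁
  obtain ⟨K₀, hK₀⟩ := (h₁.mono (Nat.le_succ s)).exists_abs_le hs (contDiff_slice (hd _) t₀)
  have hKpos : ∀ j, 0 ≤ K j := fun j => (abs_nonneg _).trans (hK j t₀ le_rfl 0)
  have hK₀pos : 0 ≤ K₀ := (abs_nonneg _).trans (hK₀ 0)
  have hKs : 0 ≤ ∑ j, K j := Finset.sum_nonneg fun j _ => hKpos j
  have hL : ∀ t, t₀ ≤ t → ∀ x,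
      |∑ j, dirDeriv (spaceVec j) (dirDeriv (spaceVec j) u) (t, x)| ≤ ∑ j, K j := fun t ht x =>
    (Finset.abs_sum_le_sum_abs _ _).trans (Finset.sum_le_sum fun j _ => hK j t ht x)
  have hn' : (2 : ℝ) < n := by exact_mod_cast hn
  refine ⟨Real.exp (2 * t₀) * K₀ + (∑ j, K j) / (n - 2), fun t ht x => abs_le'.2 ⟨?_, ?_⟩⟩
  · exact le_mul_exp_of_hasDerivAt (P := fun t => dirDeriv timeVec u (t, x)) hn' hK₀pos hKs
      (fun s _ => hasDerivAt_slice (hd timeVec) s x)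
      (fun s hs => hwave s hs x) (fun s hs => (le_abs_self _).trans (hL s hs x))
      ((le_abs_self _).trans (hK₀ x)) ht
  · exact le_mul_exp_of_hasDerivAt (P := fun t => -dirDeriv timeVec u (t, x)) hn' hK₀pos hKs
      (fun s _ => (hasDerivAt_slice (hd timeVec) s x).neg)
      (L := fun s => -∑ j, dirDeriv (spaceVec j) (dirDeriv (spaceVec j) u) (s, x))
      (fun s hs => by linear_combination -hwave s hs x)
      (fun s hs => (neg_le_abs _).trans (hL s hs x))
      ((neg_le_abs _).trans (hK₀ x)) ht

end DeSitter

/-! ### The Cauchy problem on `I × ℝⁿ`. -/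

theorem theorem2 (n : ℕ) (hn : 2 < n) (k : ℕ) (hk : (n : ℝ) / 2 + 2 < (k : ℝ))
    (tstar t₀ : ℝ) (ht₀ : t₀ ∈ Set.Ioi tstar)
    (φ₀ φ₁ : DeSitter.Space n → ℝ)
    (hφ₀ : DeSitter.MemH k φ₀) (hφ₁ : DeSitter.MemH (k - 1) φ₁)
    (φ : DeSitter.Spacetime n → ℝ)
    (hsmooth : ContDiffOn ℝ ∞ φ (Set.Ioi tstar ×ˢ Set.univ))
    (hwave : ∀ t : ℝ, t₀ ≤ t → ∀ x : DeSitter.Space n,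
      DeSitter.dAlembertian (DeSitter.metric n) φ (t, x) = 0)
    (hinit₀ : ∀ x : DeSitter.Space n, φ (t₀, x) = φ₀ x)
    (hinit₁ : ∀ x : DeSitter.Space n, deriv (fun s : ℝ => φ (s, x)) t₀ = φ₁ x) :
    ∃ C : ℝ, ∀ t : ℝ, t₀ ≤ t →
      eLpNorm (fun x : DeSitter.Space n => deriv (fun s : ℝ => φ (s, x)) t) ∞ volume
        ≤ ENNReal.ofReal (C * DeSitter.scaleFactor t ^ (-2 : ℤ)) := by
  open DeSitter in
  obtain ⟨u, hu, t₁, ht₁, hφu⟩ := exists_contDiff_eq_of_contDiffOn ht₀ hsmooth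
  have hk2 : n + 4 < 2 * k := by
    have : (n : ℝ) + 4 < 2 * k := by linarith
    exact_mod_cast this
  -- Two derivatives are spent on `Δφ`; the remaining `s > n/2` are those of the Sobolev inequality.
  obtain ⟨s, rfl⟩ : ∃ s, k = s + 2 := ⟨k - 2, by omega⟩
  have hder : ∀ t, t₀ ≤ t → ∀ x, deriv (fun s => φ (s, x)) t = dirDeriv timeVec u (t, x) := by
    intro t ht x
    refine ((hasDerivAt_slice hu t x).congr_of_eventuallyEq ?_).deriv
    filter_upwards [Ioi_mem_nhds (ht₁.trans_le ht)] with s hs using hφu s hs x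
  have hsolves : SolvesWave t₀ u := by
    intro t ht x
    have hev : φ =ᶠ[nhds (t, x)] u := by
      filter_upwards [(isOpen_Ioi.prod isOpen_univ).mem_nhds
        (⟨ht₁.trans_le ht, mem_univ _⟩ : (t, x) ∈ Ioi t₁ ×ˢ (univ : Set (Space n)))] with q hq
      exact hφu q.1 hq.1 q.2
    have h := hwave t ht x
    rw [dAlembertian_congr hev, dAlembertian_metric hu] at h
    simp only at h
    linarith
  have h₀ : (fun x => u (t₀, x)) = φ₀ := funext fun x => by rw [← hφu t₀ ht₁, hinit₀]
  have h₁ : (fun x => dirDeriv timeVec u (t₀, x)) = φ₁ := funext fun x => by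
    rw [← hder t₀ le_rfl, hinit₁]
  obtain ⟨C, hC⟩ := hsolves.exists_abs_dirDeriv_timeVec_le hn (s := s) (by omega) hu
    (h₀ ▸ hφ₀) (h₁ ▸ hφ₁)
  refine ⟨C, fun t ht => ?_⟩
  rw [eLpNorm_exponent_top]
  refine eLpNormEssSup_le_of_ae_bound (.of_forall fun x => ?_)
  rw [Real.norm_eq_abs, hder t ht]
  refine (hC t ht x).trans_eq ?_
  rw [scaleFactor, zpow_neg, Real.exp_neg, mul_comm 2 t, Real.exp_mul]
  norm_cast
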